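/- Let the labels range over a countably infinite set. Binary session types are the closed terms of the grammar $$T ::= \oplus\{l_i:T_i\}_{i\in I}\ \mid\ \&\{l_i:T_i\}_{i\in I}\ \mid\ \mu t.T\ \mid\ t\ \mid\ \mathbf{end},$$ where $I$ is finite and non-empty, the labels in each output selection ($\oplus$) or input branching ($\&$) are pairwise distinct, and recursion is guarded: in $\mu t.T$, the variable $t$ occurs in $T$ only within the scope of a selection or branching. Let $\mathrm{unf}^1$ replace each outermost recursion $\mu t.T$ by $T\{\mu t.T/t\}$, leaving the surrounding selections and branchings in place, and let $\mathrm{unf}^n$ be its $n$-fold iterate ($\mathrm{unf}^0 T=T$). An input context is a term $\mathcal A ::= [\,]^k \mid \&\{l_i:\mathcal A_i\}_{i\in I}$ in which, for some $m\ge 1$, each of the holes $[\,]^1,\dots,[\,]^m$ occurs exactly once and there are no others; $\mathcal A[T_k]^{k\in\{1,\dots,m\}}$ is the result of filling each hole $k$ with $T_k$. A relation $\mathcal R$ on session types is an asynchronous subtyping relation if $(T,S)\in\mathcal R$ implies: 1. if $T=\mathbf{end}$, then $\mathrm{unf}^n S=\mathbf{end}$ for some $n\ge 0$; 2. if $T=\oplus\{l_i:T_i\}_{i\in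 I}$, then there are $n\ge 0$ and an input context $\mathcal A$ with $\mathrm{unf}^n S=\mathcal A[\oplus\{l_j:S_{kj}\}_{j\in J_k}]^{k\in\{1,\dots,m\}}$ such that $I\subseteq J_k$ for all $k$; $(T_i,\mathcal A[S_{ki}]^{k\in\{1,\dots,m\}})\in\mathcal R$ for all $i\in I$; and, if $\mathcal A\ne[\,]^1$, every $T_i$ contains at least one input branching; 3. if $T=\&\{l_i:T_i\}_{i\in I}$, then $\mathrm{unf}^n S=\&\{l_j:S_j\}_{j\in J}$ for some $n\ge 0$, with $J\subseteq I$ and $(T_j,S_j)\in\mathcal R$ for all $j\in J$; 4. if $T=\mu t.T'$, then $(T'\{T/t\},S)\in\mathcal R$. Here the index sets $I$, $J$, $J_k$ are compared as sets of labels. Write $T\le S$ if $(T,S)$ belongs to some asynchronous subtyping relation. The relation $\le_{\mathsf{tout}}$ (no output covariance) is defined in the same way, with the additional requirement $I=J_k$ for all $k$ in item 2; $\le_{\mathsf{tin}}$ (no input contravariance) with the additional requirement $I=J$ in item 3; and $\le_{\mathsf{tin,tout}}$ with both requirements. **Corollary (Undecidability of subtyping without co/contravariance).** The relation $\le_{\mathsf{tin,tout}}$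 is undecidable, and so are $\le_{\mathsf{tin}}$, $\le_{\mathsf{tout}}$ and $\le$: for each of these four relations there is no algorithm which, given two session types $T$ and $S$, decides whether $T$ and $S$ are related. -/

import Mathlib

namespace AsyncSession

/-- Raw terms of the grammar of binary session types
`T ::= ⊕{lᵢ : Tᵢ}_{i ∈ I} | &{lᵢ : Tᵢ}_{i ∈ I} | μt.T | t | end`.
Labels and recursion variables are natural numbers, and the finite index set `I` is `Fin n`. -/
inductive SType : Type
  | select {n : ℕ} (l : Fin n → ℕ) (T : Fin n → SType) : SType
  | branch {n : ℕ} (l : Fin n → ℕ) (T : Fin n → SType) : SType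
  | mu (t : ℕ) (T : SType) : SType
  | var (t : ℕ) : SType
  | endT : SType

namespace SType

/-- The recursion variable `t` occurs free. -/
def FreeIn (t : ℕ) : SType → Prop
  | select _ T => ∃ i, FreeIn t (T i)
  | branch _ T => ∃ i, FreeIn t (T i)
  | mu s T => s ≠ t ∧ FreeIn t T
  | var s => s = t
  | endT => False

/-- There is no free recursion variable. -/
def Closed (T : SType) : Prop := ∀ t, ¬ T.FreeIn t

/-- The recursion variable `t` has a free occurrence which is not in the scope of a selection or
branching. -/
def UnguardedIn (t : ℕ) : SType → Prop
  | select _ _ => False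
  | branch _ _ => False
  | mu s T => s ≠ t ∧ UnguardedIn t T
  | var s => s = t
  | endT => False

/-- Recursion is guarded: in each subterm `μt.T`, the variable `t` occurs in `T` only in the scope
of a selection or branching. -/
def Guarded : SType → Prop
  | select _ T => ∀ i, Guarded (T i)
  | branch _ T => ∀ i, Guarded (T i)
  | mu t T => ¬ T.UnguardedIn t ∧ Guarded T
  | var _ => True
  | endT => True

/-- Each selection and each branching has at least one choice, and its labels are pairwise
distinct. -/
def ProperChoices : SType → Prop
  | @select n l T => 0 < n ∧ Function.Injective l ∧ ∀ i, ProperChoices (T i)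
  | @branch n l T => 0 < n ∧ Function.Injective l ∧ ∀ i, ProperChoices (T i)
  | mu _ T => ProperChoices T
  | var _ => True
  | endT => True

/-- `T` is a (closed) session type. -/
structure IsSessionType (T : SType) : Prop where
  closed : T.Closed
  guarded : T.Guarded
  proper : T.ProperChoices

/-- Substitution `T{U/t}` of `U` for the free occurrences of `t`. It is only used with `U` closed,
so that no capture can occur. -/
def subst (t : ℕ) (U : SType) : SType → SType
  | select l T => select l fun i => subst t U (T i)
  | branch l T => branch l fun i => subst t U (T i)
  | mu s T => if s = t then mu s T else mu s (subst t U T)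
  | var s => if s = t then U else var s
  | endT => endT

/-- The 1-unfolding, which replaces each outermost recursion `μt.T` by `T{μt.T/t}`. -/
def unfold1 : SType → SType
  | select l T => select l fun i => unfold1 (T i)
  | branch l T => branch l fun i => unfold1 (T i)
  | mu t T => subst t (mu t T) T
  | var t => var t
  | endT => endT

/-- The `n`-unfolding. -/
def unfold : ℕ → SType → SType
  | 0, T => T
  | n + 1, T => unfold1 (unfold n T)

/-- `& ∈ T`: the term contains at least one input branching. -/
def HasInput : SType → Prop
  | select _ T => ∃ i, HasInput (T i)
  | branch _ _ => True
  | mu _ T => HasInput T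
  | var _ => False
  | endT => False

/-- A session type written as a word over `ℕ`, in prefix notation. Each choice is preceded by the
number of its alternatives, and each alternative consists of its label and its continuation. -/
def encode : SType → List ℕ
  | endT => [0]
  | var t => [1, t]
  | mu t T => 2 :: t :: encode T
  | @select n l T => 3 :: n :: (List.ofFn fun i => l i :: encode (T i)).flatten
  | @branch n l T => 4 :: n :: (List.ofFn fun i => l i :: encode (T i)).flatten

theorem encode_family {n : ℕ} (l l' : Fin n → ℕ) (T T' : Fin n → SType)
    (h : ∀ i x y, (T i).encode ++ x = (T' i).encode ++ y → T i = T' i ∧ x = y) (x y : List ℕ)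
    (e : (List.ofFn fun i => l i :: encode (T i)).flatten ++ x =
      (List.ofFn fun i => l' i :: encode (T' i)).flatten ++ y) :
    l = l' ∧ T = T' ∧ x = y := by
  induction n with
  | zero => exact ⟨funext fun i => i.elim0, funext fun i => i.elim0, by simpa using e⟩
  | succ n ih =>
    simp only [List.ofFn_succ, List.flatten_cons, List.cons_append, List.append_assoc,
      List.cons.injEq] at e
    obtain ⟨h0, h1⟩ := h 0 _ _ e.2
    obtain ⟨a, b, c⟩ := ih (fun i => l i.succ) (fun i => l' i.succ) (fun i => T i.succ)
      (fun i => T' i.succ) (fun i => h i.succ) h1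
    refine ⟨funext fun i => ?_, funext fun i => ?_, c⟩
    · exact Fin.cases e.1 (fun i => congrFun a i) i
    · exact Fin.cases h0 (fun i => congrFun b i) i

theorem encode_append (T T' : SType) (x y : List ℕ) (e : T.encode ++ x = T'.encode ++ y) :
    T = T' ∧ x = y := by
  induction T generalizing T' x y with
  | select l T ih =>
    cases T' <;> simp [encode] at e
    obtain ⟨rfl, e⟩ := e
    obtain ⟨rfl, rfl, rfl⟩ := encode_family _ _ _ _ (fun i x y h => ih i _ x y h) x y e
    exact ⟨rfl, rfl⟩
  | branch l T ih =>
    cases T' <;> simp [encode] at e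
    obtain ⟨rfl, e⟩ := e
    obtain ⟨rfl, rfl, rfl⟩ := encode_family _ _ _ _ (fun i x y h => ih i _ x y h) x y e
    exact ⟨rfl, rfl⟩
  | mu t T ih =>
    cases T' <;> simp [encode] at e
    obtain ⟨rfl, e⟩ := e
    obtain ⟨rfl, rfl⟩ := ih _ _ _ e
    exact ⟨rfl, rfl⟩
  | var t =>
    cases T' <;> simp [encode] at e
    simpa using e
  | endT =>
    cases T' <;> simp [encode] at e
    simpa using e

/-- A session type can be recovered from its word. -/
theorem encode_injective : Function.Injective encode := fun T T' e =>
  (encode_append T T' [] [] (by rw [e])).1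

end SType

/-- Input contexts `A ::= [ ]ᵏ | &{lᵢ : Aᵢ}_{i ∈ I}` with holes indexed over `Fin m`. -/
inductive InputCtx (m : ℕ) : Type
  | hole (k : Fin m) : InputCtx m
  | branch {n : ℕ} (l : Fin n → ℕ) (A : Fin n → InputCtx m) : InputCtx m

namespace InputCtx

/-- The number of occurrences of the hole `k`. -/
def count {m : ℕ} (k : Fin m) : InputCtx m → ℕ
  | hole j => if j = k then 1 else 0
  | branch _ A => ∑ i, count k (A i)

/-- There is at least one hole index, and each hole occurs exactly once. -/
def WellFormed {m : ℕ} (A : InputCtx m) : Prop := 1 ≤ m ∧ ∀ k, A.count k = 1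

/-- `A[Tₖ]`: each hole `k` is filled with `Tₖ`. -/
def fill {m : ℕ} (T : Fin m → SType) : InputCtx m → SType
  | hole k => T k
  | branch l A => SType.branch l fun i => fill T (A i)

end InputCtx

open SType

/-- `R` is an asynchronous subtyping relation. If the flag `tin` (`tout`) is set, then matching
input branchings (output selections) must moreover have the same set of labels, which is to say
that input contravariance (output covariance) is not admitted. -/
structure IsAsyncSubtyping (tin tout : Bool) (R : SType → SType → Prop) : Prop where
  endT : ∀ S, R endT S → ∃ n, unfold n S = SType.endT
  select : ∀ (a : ℕ) (l : Fin a → ℕ) (T : Fin a → SType) (S : SType), R (select l T) S →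
    ∃ (n m : ℕ) (A : InputCtx m) (b : Fin m → ℕ) (l' : ∀ k, Fin (b k) → ℕ)
      (S' : ∀ k, Fin (b k) → SType),
      A.WellFormed ∧
      unfold n S = A.fill (fun k => SType.select (l' k) (S' k)) ∧
      (∀ k, Set.range l ⊆ Set.range (l' k)) ∧
      (tout = true → ∀ k, Set.range l = Set.range (l' k)) ∧
      -- in each hole `k`, the index `j k` is that of the alternative with the label of `T i`
      (∀ (i : Fin a) (j : ∀ k, Fin (b k)), (∀ k, l' k (j k) = l i) →
        R (T i) (A.fill fun k => S' k (j k))) ∧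
      ((∀ k, A ≠ InputCtx.hole k) → ∀ i, (T i).HasInput)
  branch : ∀ (a : ℕ) (l : Fin a → ℕ) (T : Fin a → SType) (S : SType), R (branch l T) S →
    ∃ (n b : ℕ) (l' : Fin b → ℕ) (S' : Fin b → SType),
      unfold n S = SType.branch l' S' ∧
      Set.range l' ⊆ Set.range l ∧
      (tin = true → Set.range l = Set.range l') ∧
      ∀ (i : Fin a) (j : Fin b), l i = l' j → R (T i) (S' j)
  mu : ∀ (t : ℕ) (T S : SType), R (mu t T) S → R (subst t (SType.mu t T) T) S

/-- Asynchronous subtyping, restricted according to the two flags. -/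
def AsyncSubtype (tin tout : Bool) (T S : SType) : Prop :=
  ∃ R, IsAsyncSubtyping tin tout R ∧ R T S

/-- Asynchronous subtyping `≤`. -/
def LEFull : SType → SType → Prop := AsyncSubtype false false

/-- Asynchronous subtyping `≤_tin`, without input contravariance. -/
def LETin : SType → SType → Prop := AsyncSubtype true false

/-- Asynchronous subtyping `≤_tout`, without output covariance. -/
def LETout : SType → SType → Prop := AsyncSubtype false true

/-- Asynchronous subtyping `≤_{tin,tout}`, without input contravariance and output covariance. -/
def LETinTout : SType → SType → Prop := AsyncSubtype true true

/-- There is an algorithm which, for all session types `T` and `S`, decides whether `R T S`. What it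
does on words that represent no session type does not matter. -/
def IsDecidable (R : SType → SType → Prop) : Prop :=
  ∃ f : List ℕ → List ℕ → Bool, Computable₂ f ∧
    ∀ T S : SType, T.IsSessionType → S.IsSessionType →
      (f T.encode S.encode = true ↔ R T S)

end AsyncSession

/-! The halting problem is reduced to subtyping by way of queue machines. The subtype plays the
program and the supertype plays the queue: an input consumes the front symbol, and an output,
anticipated below the pending inputs of the supertype, appends a symbol behind them. A stuck machine
asks for an input where the supertype first offers an output, so `program r` can be followed against
`queue w` exactly when the machine never gets stuck.

To satisfy even the strictest relation, all choices carry the same labels `0, …, N - 1`, and the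
unintended ones must be harmless. An input that contradicts the queue leads to `wild`, which offers
two inputs per absorbed output; an output that contradicts the program leads to `noise`, which
alternates inputs and outputs. A machine step consumes at most two symbols and appends at least one,
so the supply of `wild` never runs out (`isAsyncSubtyping_follows`). Conversely, even the most
permissive relation must accept the intended labels, along which it replays the run
(`IsAsyncSubtyping.program`). Hence each of the four relations is equivalent to `Live r w` on these
pairs (`asyncSubtype_program_queue_iff`).

Liveness is undecidable because queue machines simulate stack machines: the stacks are written
around a cycle, each behind a marker, and a control symbol travels along it (`respects_stackRule`).
The stack machine of a universal partial recursive function then gives one fixed queue machine; only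
the initial queue depends on the input, primitive recursively. -/

/-! ### Queue machines -/

/-- One step of a queue machine. The rule of a symbol at the front of the queue either appends a
word, or consumes a second symbol and appends a word which depends on it. -/
def QueueMachine.step {α : Type*} (r : α → List α ⊕ (α → List α)) : List α → Option (List α)
  | [] => none
  | a :: w =>
    match r a, w with
    | .inl u, w => some (w ++ u)
    | .inr f, b :: w => some (w ++ f b)
    | .inr _, [] => none

/-- No rule of the queue machine appends the empty word. -/
def QueueMachine.Productive {α : Type*} (r : α → List α ⊕ (α → List α)) : Prop :=
  ∀ a, match r a with
    | .inl u => u ≠ []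
    | .inr f => ∀ b, f b ≠ []

/-- The queue machine never gets stuck. -/
def QueueMachine.Live {α : Type*} (r : α → List α ⊕ (α → List α)) (w : List α) : Prop :=
  ¬ (StateTransition.eval (QueueMachine.step r) w).Dom

theorem QueueMachine.Live.of_step {α : Type*} {r : α → List α ⊕ (α → List α)} {w w' : List α}
    (h : Live r w) (e : step r w = some w') : Live r w' := by
  rw [Live, ← StateTransition.reaches_eval (Relation.ReflTransGen.single e)]
  exact h

theorem QueueMachine.Live.step_ne_none {α : Type*} {r : α → List α ⊕ (α → List α)} {w : List α}
    (h : Live r w) : step r w ≠ none := fun e =>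
  h (Part.dom_iff_mem.2 ⟨w, StateTransition.mem_eval.2 ⟨.refl, e⟩⟩)

namespace AsyncSession

open SType QueueMachine

variable {N : ℕ}

/-! ### The two session types of a queue machine -/

/-- The input branching over the labels below `N`. -/
def inp (F : Fin N → SType) : SType := .branch (fun i => (i : ℕ)) F

/-- The output selection over the labels below `N`. -/
def out (F : Fin N → SType) : SType := .select (fun i => (i : ℕ)) F

variable (N) in
/-- The type which alternately consumes and produces arbitrary symbols. -/
def noise : SType := .mu 0 (inp fun _ : Fin N => out fun _ : Fin N => .var 0)

/-- Output of a word, with continuation `K`. An output which deviates from it leads to `noise`. -/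
def emit (K : SType) : List (Fin N) → SType
  | [] => K
  | b :: u => out fun a => if a = b then emit K u else noise N

/-- One step of a queue machine, with continuation `K`. -/
def readRule (r : Fin N → List (Fin N) ⊕ (Fin N → List (Fin N))) (K : SType) : SType :=
  inp fun a =>
    match r a with
    | .inl u => emit K u
    | .inr f => inp fun b => emit K (f b)

/-- The session type which runs a queue machine. -/
def program (r : Fin N → List (Fin N) ⊕ (Fin N → List (Fin N))) : SType :=
  .mu 0 (readRule r (.var 0))

variable (N) in
/-- The type which offers two arbitrary symbols for each symbol that it consumes. -/
def wild : SType := .mu 0 (inp fun _ : Fin N => inp fun _ : Fin N => out fun _ : Fin N => .var 0)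

/-- A queue with front `a` and rest `S`. An input which deviates from it leads to `wild`. -/
def cell (a : Fin N) (S : SType) : SType := inp fun b => if b = a then S else wild N

variable (N) in
/-- The empty queue. -/
def emptyQueue : SType := .mu 0 (out fun a : Fin N => cell a (.var 0))

/-- The session type of a queue. -/
def queue (w : List (Fin N)) : SType := w.foldr cell (emptyQueue N)

theorem subst_inp (t : ℕ) (U : SType) (F : Fin N → SType) :
    subst t U (inp F) = inp fun a => subst t U (F a) := rfl

theorem subst_out (t : ℕ) (U : SType) (F : Fin N → SType) :
    subst t U (out F) = out fun a => subst t U (F a) := rfl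

theorem subst_noise (U : SType) : subst 0 U (noise N) = noise N := by simp [noise, subst]

theorem subst_wild (U : SType) : subst 0 U (wild N) = wild N := by simp [wild, subst]

theorem subst_emit (U K : SType) (u : List (Fin N)) :
    subst 0 U (emit K u) = emit (subst 0 U K) u := by
  induction u with
  | nil => rfl
  | cons b u ih =>
    simp only [emit, subst_out]
    congr 1; funext a; split <;> simp [ih, subst_noise]

theorem subst_readRule (r : Fin N → List (Fin N) ⊕ (Fin N → List (Fin N))) (U K : SType) :
    subst 0 U (readRule r K) = readRule r (subst 0 U K) := by
  simp only [readRule, subst_inp]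
  congr 1; funext a
  cases r a <;> simp [subst_emit, subst_inp]

theorem subst_cell (U S : SType) (a : Fin N) :
    subst 0 U (cell a S) = cell a (subst 0 U S) := by
  simp only [cell, subst_inp]
  congr 1; funext b; split <;> simp [subst_wild]

theorem unfold1_wild :
    unfold1 (wild N) = inp fun _ : Fin N => inp fun _ : Fin N => out fun _ : Fin N => wild N := by
  simp [wild, unfold1, subst_inp, subst_out, subst]

theorem unfold1_emptyQueue :
    unfold1 (emptyQueue N) = out fun a : Fin N => cell a (emptyQueue N) := by
  conv_lhs => rw [emptyQueue]
  simp only [unfold1, subst_out, subst_cell]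
  simp [subst, emptyQueue]

/-! ### The two types are session types -/

theorem IsSessionType.inp (hN : 0 < N) {F : Fin N → SType} (h : ∀ a, (F a).IsSessionType) :
    (AsyncSession.inp F).IsSessionType :=
  ⟨fun t ⟨a, ha⟩ => (h a).closed t ha, fun a => (h a).guarded,
    hN, Fin.val_injective, fun a => (h a).proper⟩

theorem isSessionType_wild (hN : 0 < N) : (wild N).IsSessionType :=
  ⟨fun t ⟨h0, _, _, _, h⟩ => h0 h,
    by simp [wild, Guarded, AsyncSession.inp, out, UnguardedIn],
    by simp [wild, ProperChoices, AsyncSession.inp, out, hN, Fin.val_injective]⟩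

theorem isSessionType_noise (hN : 0 < N) : (noise N).IsSessionType :=
  ⟨fun t ⟨h0, _, _, h⟩ => h0 h,
    by simp [noise, Guarded, AsyncSession.inp, out, UnguardedIn],
    by simp [noise, ProperChoices, AsyncSession.inp, out, hN, Fin.val_injective]⟩

theorem isSessionType_emptyQueue (hN : 0 < N) : (emptyQueue N).IsSessionType := by
  have hw := isSessionType_wild hN
  refine ⟨fun t h => ?_, ⟨id, fun a b => ?_⟩, hN, Fin.val_injective, fun a => ⟨hN,
    Fin.val_injective, fun b => ?_⟩⟩
  · obtain ⟨h0, a, b, h⟩ := h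
    dsimp only at h
    split at h
    · exact h0 h
    · exact hw.closed t h
  · dsimp only
    split
    · trivial
    · exact hw.guarded
  · dsimp only
    split
    · trivial
    · exact hw.proper

theorem isSessionType_queue (hN : 0 < N) (w : List (Fin N)) : (queue w).IsSessionType := by
  induction w with
  | nil => exact isSessionType_emptyQueue hN
  | cons a w ih =>
    refine IsSessionType.inp hN fun b => ?_
    split
    · exact ih
    · exact isSessionType_wild hN

theorem isSessionType_program (hN : 0 < N)
    (r : Fin N → List (Fin N) ⊕ (Fin N → List (Fin N))) : (program r).IsSessionType := by
  have hn := isSessionType_noise hN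
  have free : ∀ t (u : List (Fin N)), (emit (.var 0) u).FreeIn t → 0 = t := by
    intro t u h
    induction u with
    | nil => exact h
    | cons b u ih =>
      obtain ⟨a, h⟩ := h
      dsimp only at h
      split at h
      · exact ih h
      · exact (hn.closed t h).elim
  have guarded : ∀ u : List (Fin N), (emit (.var 0) u).Guarded := by
    intro u
    induction u with
    | nil => trivial
    | cons b u ih =>
      intro a
      dsimp only
      split
      · exact ih
      · exact hn.guarded
  have proper : ∀ u : List (Fin N), (emit (.var 0) u).ProperChoices := by
    intro u
    induction u with
    | nil => trivial
    | cons b u ih =>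
      refine ⟨hN, Fin.val_injective, fun a => ?_⟩
      dsimp only
      split
      · exact ih
      · exact hn.proper
  refine ⟨fun t h => ?_, ⟨id, fun a => ?_⟩, hN, Fin.val_injective, fun a => ?_⟩
  · obtain ⟨h0, a, h⟩ := h
    dsimp only at h
    split at h
    · exact h0 (free t _ h)
    · obtain ⟨b, h⟩ := h
      exact h0 (free t _ h)
  · dsimp only
    split
    · exact guarded _
    · exact fun b => guarded _
  · dsimp only
    split
    · exact proper _
    · exact ⟨hN, Fin.val_injective, fun b => proper _⟩

/-! ### Representation of queue contents by session types -/

variable (N) in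
/-- What a session type offers: the symbols of a queue, or a number of arbitrary symbols. -/
inductive Buffer : Type
  | word (w : List (Fin N))
  | wild (k : ℕ)

namespace Buffer

/-- A symbol can be consumed. -/
def CanPop : Buffer N → Prop
  | word w => w ≠ []
  | wild k => k ≠ 0

/-- Consumption of a symbol. -/
inductive Pop : Buffer N → Fin N → Buffer N → Prop
  | hit (c : Fin N) (w : List (Fin N)) : Pop (word (c :: w)) c (word w)
  -- The count starts at 2 and grows with every output absorbed while the deviating branch is still
  -- pending, so all `k ≥ 2` must be admitted for `Pop` to be stable under `push`.
  | miss (c : Fin N) (w : List (Fin N)) {a : Fin N} {k : ℕ} (h : a ≠ c) (hk : 2 ≤ k) :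
      Pop (word (c :: w)) a (wild k)
  | wild (k : ℕ) (a : Fin N) : Pop (wild (k + 1)) a (wild k)

/-- Production of a symbol. -/
def push : Buffer N → Fin N → Buffer N
  | word w, b => word (w ++ [b])
  | wild k, _ => wild (k + 2)

theorem Pop.push {q q' : Buffer N} {a : Fin N} (h : Pop q a q') (b : Fin N) :
    Pop (q.push b) a (q'.push b) := by
  cases h with
  | hit => exact .hit _ _
  | miss c w h hk => exact .miss c _ h (by omega)
  | wild k a => exact .wild _ a

theorem canPop_push (q : Buffer N) (b : Fin N) : (q.push b).CanPop := by
  cases q <;> simp [Buffer.push, CanPop]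

end Buffer

open Buffer

/-- The session type offers the contents of the buffer, up to unfolding. -/
inductive Rep : Buffer N → SType → Prop
  | empty : Rep (.word []) (emptyQueue N)
  | wild : Rep (.wild 2) (wild N)
  | inp {q : Buffer N} {S : Fin N → SType} (f : Fin N → Buffer N) (hq : q.CanPop)
      (hf : ∀ a, Pop q a (f a)) (h : ∀ a, Rep (f a) (S a)) : Rep q (inp S)
  -- An output is exposed only over an exhausted buffer; so an unfolded type whose buffer can be
  -- popped must begin with an input.
  | out {q : Buffer N} {S : Fin N → SType} (hq : ¬ q.CanPop) (h : ∀ a, Rep (q.push a) (S a)) :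
      Rep q (out S)

namespace Rep

theorem cell {a : Fin N} {w : List (Fin N)} {S : SType} (h : Rep (.word w) S) :
    Rep (.word (a :: w)) (cell a S) := by
  refine .inp (fun b => if b = a then .word w else .wild 2) (by simp [CanPop]) (fun b => ?_)
    fun b => ?_
  · split
    · subst b; exact .hit a w
    · exact .miss a w ‹_› le_rfl
  · split
    · exact h
    · exact .wild

theorem queue (w : List (Fin N)) : Rep (.word w) (queue w) := by
  induction w with
  | nil => exact .empty
  | cons a w ih => exact ih.cell

/-- Only the loops at the leaves unfold. A round of `emptyQueue` stores the symbol it receives, and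
a round of `wild` offers two inputs before the output that restores them, so the buffer is
unchanged. -/
theorem unfold1 {q : Buffer N} {S : SType} (h : Rep q S) : Rep q (unfold1 S) := by
  induction h with
  | empty =>
    rw [unfold1_emptyQueue]
    exact .out (by simp [CanPop]) fun a => .cell .empty
  | wild =>
    rw [unfold1_wild]
    exact .inp (fun _ => .wild 1) (by simp [CanPop]) (.wild 1) fun _ =>
      .inp (fun _ => .wild 0) (by simp [CanPop]) (.wild 0) fun _ =>
      .out (by simp [CanPop]) fun _ => .wild
  | inp f hq hf h ih => exact .inp f hq hf ih
  | out hq h ih => exact .out hq ih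

theorem unfold {q : Buffer N} {S : SType} (h : Rep q S) (n : ℕ) : Rep q (unfold n S) := by
  induction n with
  | zero => exact h
  | succ n ih => exact ih.unfold1

theorem of_inp {q : Buffer N} {S : SType} (h : Rep q S) {n : ℕ} {l : Fin n → ℕ}
    {F : Fin n → SType} (e : S = .branch l F) :
    ∃ (F' : Fin N → SType) (f : Fin N → Buffer N), S = AsyncSession.inp F' ∧ q.CanPop ∧
      (∀ a, Pop q a (f a)) ∧ ∀ a, Rep (f a) (F' a) := by
  cases h with
  | empty => cases e
  | wild => cases e
  | inp f hq hf h => exact ⟨_, f, rfl, hq, hf, h⟩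
  | out hq h => cases e

theorem of_out {q : Buffer N} {S : SType} (h : Rep q S) {n : ℕ} {l : Fin n → ℕ}
    {F : Fin n → SType} (e : S = .select l F) :
    ∃ F' : Fin N → SType, S = AsyncSession.out F' ∧ ∀ a, Rep (q.push a) (F' a) := by
  cases h with
  | empty => cases e
  | wild => cases e
  | inp f hq hf h => cases e
  | out hq h => exact ⟨_, rfl, h⟩

/-- Anticipating an output below an input context produces a symbol. -/
theorem fill {m : ℕ} (A : InputCtx m) {b : Fin m → ℕ} {l : ∀ k, Fin (b k) → ℕ}
    {S : ∀ k, Fin (b k) → SType} {a : Fin N} {j : ∀ k, Fin (b k)} (hj : ∀ k, l k (j k) = a)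
    {q : Buffer N} (h : Rep q (A.fill fun k => .select (l k) (S k))) :
    Rep (q.push a) (A.fill fun k => S k (j k)) := by
  induction A generalizing q with
  | hole k =>
    obtain ⟨F, e, hF⟩ := h.of_out rfl
    have hjk := hj k
    -- The arity `b k` must become a variable before the equation between choices can be split.
    revert e hjk
    simp only [InputCtx.fill]
    generalize l k = lk, S k = Sk, j k = jk
    revert lk Sk jk
    generalize b k = bk
    intro lk Sk jk e hjk
    cases e
    rw [Fin.val_injective hjk]
    exact hF a
  | branch l' A ih =>
    obtain ⟨F, f, e, hq, hf, hF⟩ := h.of_inp rfl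
    cases e
    exact .inp (fun c => (f c).push a) (canPop_push q a) (fun c => (hf c).push a)
      fun c => ih c (hF c)

end Rep

/-! ### Input contexts -/

namespace InputCtx

/-- Renaming of the holes. -/
def rename {m m' : ℕ} (f : Fin m → Fin m') : InputCtx m → InputCtx m'
  | hole k => hole (f k)
  | branch l A => branch l fun i => rename f (A i)

theorem fill_rename {m m' : ℕ} (f : Fin m → Fin m') (S : Fin m' → SType) (A : InputCtx m) :
    (A.rename f).fill S = A.fill (S ∘ f) := by
  induction A with
  | hole k => rfl
  | branch l A ih => simp only [rename, fill, ih]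

theorem count_rename {m m' : ℕ} {f : Fin m → Fin m'} (hf : f.Injective) (A : InputCtx m)
    (k : Fin m) : (A.rename f).count (f k) = A.count k := by
  induction A with
  | hole j => simp [rename, count, hf.eq_iff]
  | branch l A ih => simp only [rename, count, ih]

theorem count_rename_of_forall_ne {m m' : ℕ} {f : Fin m → Fin m'} {k : Fin m'}
    (hk : ∀ j, f j ≠ k) (A : InputCtx m) : (A.rename f).count k = 0 := by
  induction A with
  | hole j => simp [rename, count, hk]
  | branch l A ih => simp [rename, count, ih]

/-- The branching of well-formed input contexts, with the holes made distinct. -/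
theorem exists_branch {n : ℕ} (hn : 0 < n) (l : Fin n → ℕ) {m : Fin n → ℕ}
    (A : ∀ i, InputCtx (m i)) (hA : ∀ i, (A i).WellFormed) :
    ∃ (B : InputCtx (∑ i, m i)), B.WellFormed ∧
      ∀ S : Fin (∑ i, m i) → SType,
        B.fill S = .branch l fun i => (A i).fill fun k => S (finSigmaFinEquiv ⟨i, k⟩) := by
  refine ⟨.branch l fun i => (A i).rename fun k => finSigmaFinEquiv ⟨i, k⟩, ⟨?_, fun k => ?_⟩,
    fun S => ?_⟩
  · exact (hA ⟨0, hn⟩).1.trans (Finset.single_le_sum (f := m) (fun _ _ => Nat.zero_le _)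
      (Finset.mem_univ _))
  · obtain ⟨⟨i, k⟩, rfl⟩ := finSigmaFinEquiv.surjective k
    rw [count, Finset.sum_eq_single i]
    · rw [count_rename (f := fun k => finSigmaFinEquiv ⟨i, k⟩), (hA i).2 k]
      intro a b h
      simpa using h
    · intro j _ hj
      refine count_rename_of_forall_ne (fun k' h => hj ?_) _
      exact congrArg Sigma.fst (finSigmaFinEquiv.injective h)
    · simp
  · simp only [fill, fill_rename]
    rfl

end InputCtx

/-- The 1-unfolding of a type that represents a buffer has outputs on all its paths. -/
theorem Rep.exists_fill (hN : 0 < N) {q : Buffer N} {S : SType} (h : Rep q S) :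
    ∃ (m : ℕ) (A : InputCtx m) (S' : Fin m → Fin N → SType), A.WellFormed ∧
      SType.unfold1 S = A.fill fun k => AsyncSession.out (S' k) := by
  have hole : ∀ F : Fin N → SType, ∃ (m : ℕ) (A : InputCtx m) (S' : Fin m → Fin N → SType),
      A.WellFormed ∧ AsyncSession.out F = A.fill fun k => AsyncSession.out (S' k) := fun F =>
    ⟨1, .hole 0, fun _ => F, ⟨le_rfl, fun k => by simp [InputCtx.count, Subsingleton.elim 0 k]⟩,
      rfl⟩
  have branch : ∀ F : Fin N → SType, (∀ a, ∃ (m : ℕ) (A : InputCtx m)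
      (S' : Fin m → Fin N → SType), A.WellFormed ∧
        F a = A.fill fun k => AsyncSession.out (S' k)) →
      ∃ (m : ℕ) (A : InputCtx m) (S' : Fin m → Fin N → SType), A.WellFormed ∧
        AsyncSession.inp F = A.fill fun k => AsyncSession.out (S' k) := by
    intro F hF
    choose m A S' hA e using hF
    obtain ⟨B, hB, eB⟩ := InputCtx.exists_branch hN (fun i => (i : ℕ)) A hA
    refine ⟨_, B, fun k => S' (finSigmaFinEquiv.symm k).1 (finSigmaFinEquiv.symm k).2, hB, ?_⟩
    rw [eB, AsyncSession.inp]
    congr 1; funext a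
    rw [e a]
    congr 1; funext k
    dsimp only
    rw [Equiv.symm_apply_apply]
  induction h with
  | empty => rw [unfold1_emptyQueue]; exact hole _
  | wild =>
    rw [unfold1_wild]
    exact branch _ fun _ => branch _ fun _ => hole _
  | inp f hq hf h ih => exact branch _ ih
  | out hq h ih => exact hole _

/-! ### A machine that never gets stuck yields a subtype -/

variable {r : Fin N → List (Fin N) ⊕ (Fin N → List (Fin N))}

/-- The machine can run forever on the contents of the buffer. -/
def Buffer.Safe (r : Fin N → List (Fin N) ⊕ (Fin N → List (Fin N))) : Buffer N → Prop
  | word w => Live r w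
  | wild k => 2 ≤ k

theorem Buffer.foldl_push_word (w u : List (Fin N)) :
    u.foldl push (word w) = word (w ++ u) := by
  induction u generalizing w with
  | nil => simp
  | cons b u ih => simp [push, ih]

theorem Buffer.foldl_push_wild (k : ℕ) (u : List (Fin N)) :
    u.foldl push (wild k) = wild (k + 2 * u.length) := by
  induction u generalizing k with
  | nil => simp
  | cons b u ih =>
    simp only [List.foldl_cons, push, ih, List.length_cons]
    congr 1; omega

theorem Buffer.Safe.canPop {q : Buffer N} (h : q.Safe r) : q.CanPop := by
  cases q with
  | word w => rintro rfl; exact h.step_ne_none rfl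
  | wild k => exact fun e => by simp [Safe, e] at h

theorem Buffer.Safe.of_inl {q q' : Buffer N} (h : q.Safe r) {a : Fin N} {u : List (Fin N)}
    (e : r a = .inl u) (hp : Pop q a q') (hu : u ≠ []) : (u.foldl push q').Safe r := by
  have := List.length_pos_iff.2 hu
  cases hp with
  | hit c w =>
    rw [foldl_push_word]
    exact h.of_step (by simp [step, e])
  | miss c w _ hk => rw [foldl_push_wild, Safe]; omega
  | wild k => rw [foldl_push_wild, Safe]; omega

theorem Buffer.Safe.canPop_of_inr {q q' : Buffer N} (h : q.Safe r) {a : Fin N}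
    {f : Fin N → List (Fin N)} (e : r a = .inr f) (hp : Pop q a q') : q'.CanPop := by
  cases hp with
  | hit c w => rintro rfl; exact h.step_ne_none (by simp [step, e])
  | miss c w _ hk => simp only [CanPop]; omega
  | wild k => simp only [CanPop, Safe] at h ⊢; omega

/-- On the intended path this is a machine step. Off it, some `wild k` remains, and the nonempty
word `f b` raises the count to at least 2 again. -/
theorem Buffer.Safe.of_inr {q q' q'' : Buffer N} (h : q.Safe r) {a b : Fin N}
    {f : Fin N → List (Fin N)} (e : r a = .inr f) (hp : Pop q a q') (hp' : Pop q' b q'')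
    (hu : f b ≠ []) : ((f b).foldl push q'').Safe r := by
  have := List.length_pos_iff.2 hu
  cases hp' with
  | hit c w =>
    cases hp with
    | hit =>
      rw [foldl_push_word]
      exact h.of_step (by simp [step, e])
  | miss c w _ hk => rw [foldl_push_wild, Safe]; omega
  | wild k => rw [foldl_push_wild, Safe]; omega

/-- The states of the subtype, depending on the contents of the buffer. -/
inductive Follows (r : Fin N → List (Fin N) ⊕ (Fin N → List (Fin N))) : SType → Buffer N → Prop
  | run {q : Buffer N} (h : q.Safe r) : Follows r (program r) q
  | read {q : Buffer N} (h : q.Safe r) : Follows r (readRule r (program r)) q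
  | read₂ {q : Buffer N} (f : Fin N → List (Fin N)) (hq : q.CanPop) (hf : ∀ b, f b ≠ [])
      (h : ∀ b q', Pop q b q' → ((f b).foldl push q').Safe r) :
      Follows r (inp fun b => emit (program r) (f b)) q
  | write {q : Buffer N} (b : Fin N) (u : List (Fin N)) (h : ((b :: u).foldl push q).Safe r) :
      Follows r (emit (program r) (b :: u)) q
  | noise {q : Buffer N} (hq : q.CanPop) : Follows r (noise N) q
  | noiseIn {q : Buffer N} (hq : q.CanPop) :
      Follows r (inp fun _ : Fin N => out fun _ : Fin N => AsyncSession.noise N) q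
  | noiseOut {q : Buffer N} : Follows r (out fun _ : Fin N => AsyncSession.noise N) q

theorem Follows.emit {q : Buffer N} {u : List (Fin N)} (h : (u.foldl push q).Safe r) :
    Follows r (emit (program r) u) q := by
  cases u with
  | nil => exact .run h
  | cons b u => exact .write b u h

/-- Serves the side condition on anticipated outputs; on deviating labels the input in `noise` does.
-/
theorem hasInput_program (u : List (Fin N)) : (emit (program r) u).HasInput := by
  induction u with
  | nil => trivial
  | cons b u ih => exact ⟨b, by simpa using ih⟩

/-- The two sides are coupled only through a common buffer. One unfolding always suffices: it
exposes an output on every path, and an input on top if the buffer can be popped. -/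
theorem isAsyncSubtyping_follows (hN : 0 < N) (hr : Productive r) :
    IsAsyncSubtyping true true fun T S => ∃ q : Buffer N, Rep q S ∧ Follows r T q := by
  refine ⟨?_, ?_, ?_, ?_⟩
  · rintro S ⟨q, -, h⟩
    generalize e : SType.endT = T at h
    cases h <;> cases e
  · rintro a l T S ⟨q, hS, h⟩
    have key : ∃ F : Fin N → SType, SType.select l T = out F ∧
        ∀ a, (F a).HasInput ∧ Follows r (F a) (q.push a) := by
      generalize e : SType.select l T = T' at h
      cases h with
      | run => cases e
      | read => cases e
      | read₂ => cases e
      | noise => cases e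
      | noiseIn => cases e
      | noiseOut => exact ⟨_, rfl, fun a => ⟨trivial, .noise (canPop_push q a)⟩⟩
      | write b u h =>
        refine ⟨_, rfl, fun a => ?_⟩
        split
        · subst a
          exact ⟨hasInput_program u, .emit h⟩
        · exact ⟨trivial, .noise (canPop_push q a)⟩
    obtain ⟨F, e, hF⟩ := key
    cases e
    obtain ⟨m, A, S', hA, e⟩ := hS.exists_fill hN
    refine ⟨1, m, A, fun _ => N, fun _ i => i, S', hA, e, fun _ => subset_rfl, fun _ _ => rfl,
      fun i j hj => ⟨q.push i, ?_, (hF i).2⟩, fun _ i => (hF i).1⟩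
    have := hS.unfold1
    rw [e] at this
    exact this.fill A (l := fun _ i => (i : ℕ)) hj
  · rintro a l T S ⟨q, hS, h⟩
    have key : ∃ F : Fin N → SType, SType.branch l T = inp F ∧ q.CanPop ∧
        ∀ a q', Pop q a q' → Follows r (F a) q' := by
      generalize e : SType.branch l T = T' at h
      cases h with
      | run => cases e
      | noise => cases e
      | noiseOut => cases e
      | write => cases e
      | noiseIn hq => exact ⟨_, rfl, hq, fun a q' _ => .noiseOut⟩
      | read h =>
        refine ⟨_, rfl, h.canPop, fun a q' hp => ?_⟩
        have hra := hr a
        split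
        · rename_i u e
          rw [e] at hra
          exact .emit (h.of_inl e hp hra)
        · rename_i f e
          rw [e] at hra
          exact .read₂ f (h.canPop_of_inr e hp) hra
            fun b q'' hp' => h.of_inr e hp hp' (hra b)
      | read₂ f hq hf h => exact ⟨_, rfl, hq, fun a q' hp => .emit (h a q' hp)⟩
    obtain ⟨F, e, hq, hF⟩ := key
    cases e
    have h1 : ∃ F', SType.unfold1 S = inp F' ∧ ∃ f : Fin N → Buffer N,
        (∀ a, Pop q a (f a)) ∧ ∀ a, Rep (f a) (F' a) := by
      obtain ⟨m, A, S', hA, e⟩ := hS.exists_fill hN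
      generalize hU : SType.unfold1 S = U at e
      -- `U` is a filled input context, hence a choice and not one of the recursive leaves.
      have hrep : Rep q U := hU ▸ hS.unfold1
      cases hrep with
      | empty => cases A <;> cases e
      | wild => cases A <;> cases e
      | inp f hq hf h => exact ⟨_, rfl, f, hf, h⟩
      | out hq' => exact (hq' hq).elim
    obtain ⟨F', e, f, hf, hF'⟩ := h1
    refine ⟨1, N, fun i => i, F', e, subset_rfl, fun _ => rfl, fun i j hij => ?_⟩
    cases Fin.val_injective hij
    exact ⟨f i, hF' i, hF i _ (hf i)⟩
  · rintro t T S ⟨q, hS, h⟩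
    refine ⟨q, hS, ?_⟩
    generalize e : SType.mu t T = T' at h
    cases h with
    | run h =>
      cases e
      have := Follows.read h
      rwa [show readRule r (program r) = subst 0 (program r) (readRule r (.var 0)) by
        rw [subst_readRule]; simp [subst]] at this
    | noise hq =>
      cases e
      exact .noiseIn hq
    | read => cases e
    | read₂ => cases e
    | write => cases e
    | noiseIn => cases e
    | noiseOut => cases e

theorem letinTout_of_live (hN : 0 < N) (hr : Productive r) {w : List (Fin N)} (h : Live r w) :
    LETinTout (program r) (queue w) :=
  ⟨_, isAsyncSubtyping_follows hN hr, .word w, .queue w, .run h⟩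

/-! ### A machine that gets stuck yields no subtype -/

/-- Covariance may add labels in the holes but cannot remove the intended one, so each symbol of `u`
is appended in turn. -/
theorem IsAsyncSubtyping.emit {R : SType → SType → Prop} (hR : IsAsyncSubtyping false false R)
    {K S : SType} {u w : List (Fin N)} (h : R (emit K u) S) (hS : Rep (.word w) S) :
    ∃ S', R K S' ∧ Rep (.word (w ++ u)) S' := by
  induction u generalizing w S with
  | nil => exact ⟨S, h, by simpa using hS⟩
  | cons b u ih =>
    obtain ⟨n, m, A, c, l', S', -, e, hl, -, hA, -⟩ := hR.select _ _ _ _ h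
    have : ∀ k, ∃ j, l' k j = b := fun k => hl k ⟨b, rfl⟩
    choose j hj using this
    have h1 := hA b j hj
    rw [if_pos rfl] at h1
    have h2 := hS.unfold n
    rw [e] at h2
    obtain ⟨S'', h3, h4⟩ := ih h1 (h2.fill A hj)
    exact ⟨S'', h3, by simpa using h4⟩

theorem IsAsyncSubtyping.inp {R : SType → SType → Prop} (hR : IsAsyncSubtyping false false R)
    {F : Fin N → SType} {S : SType} {w : List (Fin N)} (h : R (inp F) S)
    (hS : Rep (.word w) S) :
    ∃ c w', w = c :: w' ∧ ∃ S', R (F c) S' ∧ Rep (.word w') S' := by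
  obtain ⟨n, b, l', S', e, -, -, hF⟩ := hR.branch _ _ _ _ h
  have h2 := hS.unfold n
  rw [e] at h2
  obtain ⟨F', f, e', hq, hf, hF'⟩ := h2.of_inp rfl
  cases e'
  cases w with
  | nil => exact (hq rfl).elim
  | cons c w =>
    -- Among all offered labels, the one to follow is the symbol at the front of the queue.
    refine ⟨c, w, rfl, F' c, hF c c rfl, ?_⟩
    have h3 := hF' c
    have h4 := hf c
    generalize f c = q' at h3 h4
    cases h4 with
    | hit => exact h3
    | miss _ _ h => exact (h rfl).elim

theorem IsAsyncSubtyping.program {R : SType → SType → Prop}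
    (hR : IsAsyncSubtyping false false R) {S : SType} {w : List (Fin N)}
    (h : R (program r) S) (hS : Rep (.word w) S) :
    ∃ w' S', step r w = some w' ∧ R (program r) S' ∧ Rep (.word w') S' := by
  have h1 := hR.mu _ _ _ h
  rw [show subst 0 _ (readRule r (.var 0)) = readRule r (AsyncSession.program r) by
    rw [subst_readRule]; simp [subst, AsyncSession.program]] at h1
  obtain ⟨c, w, rfl, S', h2, hS'⟩ := hR.inp h1 hS
  cases e : r c with
  | inl u =>
    simp only [e] at h2
    obtain ⟨S'', h3, hS''⟩ := hR.emit h2 hS'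
    exact ⟨_, S'', by simp [step, e], h3, hS''⟩
  | inr f =>
    simp only [e] at h2
    obtain ⟨b, w, rfl, S', h2, hS'⟩ := hR.inp h2 hS'
    obtain ⟨S'', h3, hS''⟩ := hR.emit h2 hS'
    exact ⟨_, S'', by simp [step, e], h3, hS''⟩

theorem live_of_leFull {w : List (Fin N)} (h : LEFull (program r) (queue w)) : Live r w := by
  obtain ⟨R, hR, h⟩ := h
  intro hd
  obtain ⟨v, hv⟩ := Part.dom_iff_mem.1 hd
  obtain ⟨hvr, e⟩ := StateTransition.mem_eval.1 hv
  have key : ∃ S, R (program r) S ∧ Rep (.word v) S := by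
    clear hd e hv
    induction hvr with
    | refl => exact ⟨_, h, .queue w⟩
    | tail _ h2 ih =>
      obtain ⟨S, hS, hrep⟩ := ih
      obtain ⟨w', S', e', h'⟩ := hR.program hS hrep
      cases Option.some.inj (e'.symm.trans h2)
      exact ⟨S', h'⟩
  obtain ⟨S, hS, hrep⟩ := key
  obtain ⟨w', S', e', -⟩ := hR.program hS hrep
  simp [e] at e'

/-! ### All four relations at once -/

theorem AsyncSubtype.mono {tin tout tin' tout' : Bool} (hi : tin' = true → tin = true)
    (ho : tout' = true → tout = true) {T S : SType} (h : AsyncSubtype tin tout T S) :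
    AsyncSubtype tin' tout' T S := by
  obtain ⟨R, hR, h⟩ := h
  refine ⟨R, ⟨hR.endT, fun a l T S h => ?_, fun a l T S h => ?_, hR.mu⟩, h⟩
  · obtain ⟨n, m, A, b, l', S', h1, h2, h3, h4, h5⟩ := hR.select a l T S h
    exact ⟨n, m, A, b, l', S', h1, h2, h3, fun e => h4 (ho e), h5⟩
  · obtain ⟨n, b, l', S', h1, h2, h3, h4⟩ := hR.branch a l T S h
    exact ⟨n, b, l', S', h1, h2, fun e => h3 (hi e), h4⟩

theorem asyncSubtype_program_queue_iff (hN : 0 < N) (hr : Productive r) (tin tout : Bool)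
    (w : List (Fin N)) : AsyncSubtype tin tout (program r) (queue w) ↔ Live r w :=
  ⟨fun h => live_of_leFull (h.mono (by simp) (by simp)),
    fun h => (letinTout_of_live hN hr h).mono (by simp) (by simp)⟩

end AsyncSession

/-! ### Queue machines simulate stack machines -/

namespace QueueMachine

open Turing StateTransition

theorem live_iff_of_respects {α β : Type*} {f : β → Option β}
    {r : α → List α ⊕ (α → List α)} {tr : β → List α → Prop} (h : Respects f (step r) tr)
    {b : β} {w : List α} (hb : tr b w) : Live r w ↔ ¬ (eval f b).Dom :=
  not_congr (tr_eval_dom h hb)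

/-- A queue machine that uses only finitely many symbols can be given the alphabet `Fin N`. -/
theorem exists_fin {α : Type*} {r : α → List α ⊕ (α → List α)} (hr : Productive r) {G : Set α}
    (hG : G.Finite) (hne : G.Nonempty)
    (hcl : ∀ a ∈ G, match r a with
      | .inl u => ∀ x ∈ u, x ∈ G
      | .inr f => ∀ b ∈ G, ∀ x ∈ f b, x ∈ G) :
    ∃ N, 0 < N ∧ ∃ (r' : Fin N → List (Fin N) ⊕ (Fin N → List (Fin N))) (enc : α → Fin N),
      Productive r' ∧ ∀ w, (∀ x ∈ w, x ∈ G) → (Live r' (w.map enc) ↔ Live r w) := by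
  classical
  obtain ⟨a₀, h₀⟩ := hne
  have : Finite G := hG
  obtain ⟨N, ⟨e⟩⟩ := Finite.exists_equiv_fin G
  -- Symbols outside `G` never occur in a run, so their code is arbitrary.
  let enc : α → Fin N := fun a => if h : a ∈ G then e ⟨a, h⟩ else e ⟨a₀, h₀⟩
  let dec : Fin N → α := fun i => (e.symm i).1
  have hdec : ∀ a ∈ G, dec (enc a) = a := fun a h => by simp [enc, dec, h]
  let r' : Fin N → List (Fin N) ⊕ (Fin N → List (Fin N)) := fun i =>
    match r (dec i) with
    | .inl u => .inl (u.map enc)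
    | .inr f => .inr fun j => (f (dec j)).map enc
  refine ⟨N, (e ⟨a₀, h₀⟩).pos, r', enc, fun i => ?_, fun w hw => ?_⟩
  · have := hr (dec i)
    simp only [r']
    cases e : r (dec i) with
    | inl u => simpa [e] using this
    | inr f =>
      simp only [e] at this
      exact fun b => by simpa using this (dec b)
  · have hresp : Respects (step r) (step r')
        fun w w' => (∀ x ∈ w, x ∈ G) ∧ w' = w.map enc := by
      rintro w _ ⟨hw, rfl⟩
      cases w with
      | nil => rfl
      | cons a w =>
        have ha := hcl a (hw a (by simp))
        have hra : r' (enc a) = match r a with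
            | .inl u => .inl (u.map enc)
            | .inr f => .inr fun j => (f (dec j)).map enc := by
          simp only [r', hdec a (hw a (by simp))]
        cases e : r a with
        | inl u =>
          simp only [e] at ha hra
          simp only [step, e]
          refine ⟨_, ⟨fun x hx => ?_, rfl⟩, .single (by simp [step, hra])⟩
          rcases List.mem_append.1 hx with hx | hx
          · exact hw x (by simp [hx])
          · exact ha x hx
        | inr f =>
          simp only [e] at ha hra
          cases w with
          | nil => simp [step, e, hra]
          | cons b w =>
            simp only [step, e]
            refine ⟨_, ⟨fun x hx => ?_, rfl⟩,
              .single (by simp [step, hra, hdec b (hw b (by simp))])⟩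
            rcases List.mem_append.1 hx with hx | hx
            · exact hw x (by simp [hx])
            · exact ha b (hw b (by simp)) x hx
    exact (live_iff_of_respects hresp ⟨hw, rfl⟩).trans Iff.rfl

/-! ### The simulating machine -/

/-- The control symbols of a queue machine that simulates a stack machine. -/
inductive Ctrl (K A Λ σ : Type*)
  /-- Look for the stack of the statement, and execute the statement. -/
  | run (q : TM2.Stmt (fun _ : K => A) Λ σ) (v : σ)
  /-- Execute the statement on the stack whose marker has just been passed. -/
  | after (q : TM2.Stmt (fun _ : K => A) Λ σ) (v : σ)
  /-- Empty the queue. -/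
  | erase

variable {K A Λ σ : Type*}

/-- The contents of the stacks as a word, each behind its marker. -/
def stackWord (ks : List K) (S : K → List A) : List (K ⊕ A) :=
  ks.flatMap fun k => .inl k :: (S k).map .inr

theorem inl_mem_stackWord {ks : List K} {S : K → List A} {k : K} :
    .inl k ∈ stackWord ks S ↔ k ∈ ks := by
  simp [stackWord]

/-- The contents of a stack are followed by a marker or by nothing, so reading past an empty stack
never finds a stack symbol. -/
theorem head?_stackWord (ks : List K) (S : K → List A) (x : A) :
    (stackWord ks S).head? ≠ some (.inr x) := by
  cases ks <;> simp [stackWord]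

/-- Each stack can be rotated to the front. -/
theorem stackWord_isRotated [DecidableEq K] {ks : List K} (hks : ks.Nodup) {k : K} (hk : k ∈ ks)
    (S : K → List A) : ∃ z : List (K ⊕ A), .inl k ∉ z ∧ (∀ x, z.head? ≠ some (.inr x)) ∧
      ∀ s, stackWord ks (Function.update S k s) ~r .inl k :: (s.map .inr ++ z) := by
  obtain ⟨k₁, k₂, rfl⟩ := List.append_of_mem hk
  have hn : k ∉ k₂ ++ k₁ := by
    have := List.perm_append_comm.nodup_iff.1 hks
    simp at this ⊢
    tauto
  refine ⟨stackWord (k₂ ++ k₁) S, by rwa [inl_mem_stackWord], head?_stackWord _ S, fun s => ?_⟩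
  have h : ∀ ks : List K, k ∉ ks → stackWord ks (Function.update S k s) = stackWord ks S := by
    intro ks hk
    refine List.flatMap_congr fun k' hk' => ?_
    rw [Function.update_of_ne (by rintro rfl; exact hk hk')]
  have e : stackWord (k₁ ++ k :: k₂) (Function.update S k s) =
      stackWord k₁ S ++ (.inl k :: (s.map .inr ++ stackWord k₂ S)) := by
    rw [← h k₁ (by simp_all), ← h k₂ (by simp_all)]
    simp [stackWord]
  rw [e]
  refine List.isRotated_append.trans ?_
  simp only [stackWord, List.flatMap_append, List.cons_append, List.append_assoc]
  exact List.IsRotated.refl _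

variable [DecidableEq K] [DecidableEq A]

open TM2.Stmt in
/-- The word which replaces the symbol behind the control symbol, and the new control symbol. -/
def Ctrl.next (M : Λ → TM2.Stmt (fun _ : K => A) Λ σ) :
    Ctrl K A Λ σ → K ⊕ A → List (K ⊕ A) × Ctrl K A Λ σ
  | .run (push k f q) v, a =>
    if a = .inl k then ([.inl k, .inr (f v)], .run q v) else ([a], .run (push k f q) v)
  | .run (peek k f q) v, a =>
    if a = .inl k then ([.inl k], .after (peek k f q) v) else ([a], .run (peek k f q) v)
  | .run (pop k f q) v, a =>
    if a = .inl k then ([.inl k], .after (pop k f q) v) else ([a], .run (pop k f q) v)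
  | .run (load f q) v, a => ([a], .run q (f v))
  | .run (branch p q₁ q₂) v, a => ([a], .run (cond (p v) q₁ q₂) v)
  | .run (goto l) v, a => ([a], .run (M (l v)) v)
  | .run halt _, a => ([a], .erase)
  | .after (peek _ f q) v, .inl k => ([.inl k], .run q (f v none))
  | .after (peek _ f q) v, .inr x => ([.inr x], .run q (f v (some x)))
  | .after (pop _ f q) v, .inl k => ([.inl k], .run q (f v none))
  | .after (pop _ f q) v, .inr x => ([], .run q (f v (some x)))
  | .after _ _, a => ([a], .erase)
  | .erase, _ => ([], .erase)

/-- The rules of the queue machine that simulates a stack machine. The symbols are the markers of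
the stacks, the symbols on the stacks, and the control symbols. -/
def stackRule (M : Λ → TM2.Stmt (fun _ : K => A) Λ σ) :
    (K ⊕ A) ⊕ Ctrl K A Λ σ →
      List ((K ⊕ A) ⊕ Ctrl K A Λ σ) ⊕ ((K ⊕ A) ⊕ Ctrl K A Λ σ → List ((K ⊕ A) ⊕ Ctrl K A Λ σ))
  | .inl a => .inl [.inl a]
  | .inr c => .inr fun
    | .inl a => (c.next M a).1.map .inl ++ [.inr (c.next M a).2]
    -- Never used on a `tape`, which holds a single control symbol.
    | .inr _ => [.inr .erase]

theorem productive_stackRule (M : Λ → TM2.Stmt (fun _ : K => A) Λ σ) :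
    Productive (stackRule M) := by
  rintro (a | c)
  · simp [stackRule]
  · rintro (b | b) <;> simp

/-- The queue with the control symbol in front. -/
def tape (c : Ctrl K A Λ σ) (u : List (K ⊕ A)) : List ((K ⊕ A) ⊕ Ctrl K A Λ σ) :=
  .inr c :: u.map .inl

variable {M : Λ → TM2.Stmt (fun _ : K => A) Λ σ}

theorem reaches_rotate (x : List (K ⊕ A)) (y : List ((K ⊕ A) ⊕ Ctrl K A Λ σ)) :
    Reaches (step (stackRule M)) (x.map .inl ++ y) (y ++ x.map .inl) := by
  induction x generalizing y with
  | nil => simpa using! Relation.ReflTransGen.refl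
  | cons a x ih =>
    refine Relation.ReflTransGen.head (b := x.map .inl ++ (y ++ [.inl a])) ?_ ?_
    · simp [step, stackRule]
    · have := ih (y ++ [.inl a])
      rwa [List.append_assoc] at this

/-- The control symbol acts on its neighbour and goes to the back; the plain symbols before it then
rotate past until it is in front again. -/
theorem reaches_next (c : Ctrl K A Λ σ) (a : K ⊕ A) (u : List (K ⊕ A)) :
    Reaches₁ (step (stackRule M)) (tape c (a :: u))
      (tape (c.next M a).2 (u ++ (c.next M a).1)) := by
  refine Relation.TransGen.head' ?_
    (reaches_rotate (M := M) (u ++ (c.next M a).1) [.inr (c.next M a).2])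
  simp [step, stackRule, tape]

theorem reaches_pass {c : Ctrl K A Λ σ} {x : List (K ⊕ A)}
    (h : ∀ b ∈ x, c.next M b = ([b], c)) (y : List (K ⊕ A)) :
    Reaches (step (stackRule M)) (tape c (x ++ y)) (tape c (y ++ x)) := by
  induction x generalizing y with
  | nil => simpa using! Relation.ReflTransGen.refl
  | cons b x ih =>
    have h1 := reaches_next (M := M) c b (x ++ y)
    rw [h b (by simp)] at h1
    have h2 := ih (fun b hb => h b (by simp [hb])) (y ++ [b])
    refine h1.to_reflTransGen.trans ?_
    simpa using! h2

/-- The control symbol finds a marker. -/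
theorem reaches_marker {c : Ctrl K A Λ σ} {k : K}
    (h : ∀ b, b ≠ .inl k → c.next M b = ([b], c)) {u z : List (K ⊕ A)}
    (hu : u ~r .inl k :: z) (hz : .inl k ∉ z) :
    Reaches (step (stackRule M)) (tape c u) (tape c (.inl k :: z)) := by
  obtain ⟨n, hn, rfl⟩ := List.isRotated_iff_mod.1 hu.symm
  rw [List.rotate_eq_drop_append_take hn]
  -- Either the marker is already in front, or only symbols of `z` precede it, and these are passed
  -- unchanged.
  cases n with
  | zero => simpa using! Relation.ReflTransGen.refl
  | succ n =>
    have := reaches_pass (M := M) (c := c) (x := z.drop n)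
      (fun b hb => h b (by rintro rfl; exact hz (List.mem_of_mem_drop hb))) (.inl k :: z.take n)
    simpa using! this

theorem reaches_erase (u : List (K ⊕ A)) :
    Reaches (step (stackRule M)) (tape .erase u) (tape .erase []) := by
  induction u with
  | nil => exact .refl
  | cons a u ih =>
    have := (reaches_next (M := M) .erase a u).to_reflTransGen
    simp only [Ctrl.next, List.append_nil] at this
    exact this.trans ih

/-- The queue represents a configuration of the stack machine. -/
def Represents (M : Λ → TM2.Stmt (fun _ : K => A) Λ σ) (ks : List K)
    (c : TM2.Cfg (fun _ : K => A) Λ σ) (w : List ((K ⊕ A) ⊕ Ctrl K A Λ σ)) : Prop :=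
  match c.l with
  | some l => ∃ u, w = tape (.run (M l) c.var) u ∧ u ~r stackWord ks c.stk
  | none => w = tape .erase []

/-- The queue need only agree with the stacks up to rotation, so it does not matter where a
statement leaves the control symbol. -/
theorem reaches_stepAux {ks : List K} (hks : ks.Nodup) (hmem : ∀ k, k ∈ ks) [Nonempty K]
    (q : TM2.Stmt (fun _ : K => A) Λ σ) (v : σ) (S : K → List A) {u : List (K ⊕ A)}
    (hu : u ~r stackWord ks S) :
    ∃ w, Represents M ks (TM2.stepAux q v S) w ∧
      Reaches₁ (step (stackRule M)) (tape (.run q v) u) w := by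
  -- There is at least one marker, so statements that touch no stack still have a symbol to consume
  -- and put back.
  have hcons : ∀ {u : List (K ⊕ A)} {S : K → List A}, u ~r stackWord ks S →
      ∃ a u', u = a :: u' ∧ u' ++ [a] ~r stackWord ks S := by
    intro u S hu
    cases u with
    | nil =>
      have h := (inl_mem_stackWord (S := S)).2 (hmem (Classical.arbitrary K))
      rw [← hu.mem_iff] at h
      simp at h
    | cons a u => exact ⟨a, u, rfl, List.isRotated_append.trans hu⟩
  have hstack : ∀ {u : List (K ⊕ A)} {S : K → List A}, u ~r stackWord ks S → ∀ k,
      ∃ z : List (K ⊕ A), (∀ x, z.head? ≠ some (.inr x)) ∧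
      (∀ s, stackWord ks (Function.update S k s) ~r .inl k :: (s.map .inr ++ z)) ∧
      ∀ c : Ctrl K A Λ σ, (∀ b, b ≠ .inl k → c.next M b = ([b], c)) →
        Reaches (step (stackRule M)) (tape c u) (tape c (.inl k :: ((S k).map .inr ++ z))) := by
    intro u S hu k
    obtain ⟨z, hz, hz', h⟩ := stackWord_isRotated hks (hmem k) S
    have := h (S k)
    rw [Function.update_eq_self] at this
    exact ⟨z, hz', h, fun c hc => reaches_marker hc (hu.trans this) (by simpa using hz)⟩
  induction q generalizing v S u with
  | push k f q ih =>
    obtain ⟨z, -, h, hr⟩ := hstack hu k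
    have h1 := hr (.run (.push k f q) v) fun b hb => by simp [Ctrl.next, hb]
    have h2 := reaches_next (M := M) (.run (.push k f q) v) (.inl k) ((S k).map .inr ++ z)
    simp only [Ctrl.next, if_true] at h2
    have hrot : (S k).map .inr ++ z ++ [.inl k, .inr (f v)] ~r
        stackWord ks (Function.update S k (f v :: S k)) := by
      refine List.isRotated_append.trans ?_
      exact (h (f v :: S k)).symm
    obtain ⟨w, hw, h3⟩ := ih v _ hrot
    exact ⟨w, hw, (h2.trans_right h1).trans h3⟩
  | peek k f q ih =>
    obtain ⟨z, hz, h, hr⟩ := hstack hu k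
    have h1 := hr (.run (.peek k f q) v) fun b hb => by simp [Ctrl.next, hb]
    have h2 := reaches_next (M := M) (.run (.peek k f q) v) (.inl k) ((S k).map .inr ++ z)
    have h' := h (S k)
    rw [Function.update_eq_self] at h'
    simp only [Ctrl.next, if_true] at h2
    obtain ⟨a, y, hy, hrot⟩ := hcons (u := (S k).map .inr ++ z ++ [.inl k])
      (List.isRotated_append.trans h'.symm)
    rw [hy] at h2
    have h3 := reaches_next (M := M) (.after (.peek k f q) v) a y
    have e : Ctrl.next M (.after (.peek k f q) v) a = ([a], .run q (f v (S k).head?)) := by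
      cases hS : S k with
      | nil =>
        cases z with
        -- With a single empty stack, the symbol behind the marker is that marker itself, come round
        -- again.
        | nil => simp_all [Ctrl.next]; obtain ⟨rfl, -⟩ := hy; rfl
        | cons b z =>
          simp [hS] at hy
          obtain ⟨rfl, -⟩ := hy
          cases b with
          | inl k' => rfl
          | inr x => exact (hz x rfl).elim
      | cons x s =>
        simp [hS] at hy
        obtain ⟨rfl, -⟩ := hy
        rfl
    rw [e] at h3
    obtain ⟨w, hw, h4⟩ := ih (f v (S k).head?) S hrot
    exact ⟨w, hw, ((h2.trans_right h1).trans h3).trans h4⟩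
  | pop k f q ih =>
    obtain ⟨z, hz, h, hr⟩ := hstack hu k
    have h1 := hr (.run (.pop k f q) v) fun b hb => by simp [Ctrl.next, hb]
    have h2 := reaches_next (M := M) (.run (.pop k f q) v) (.inl k) ((S k).map .inr ++ z)
    simp only [Ctrl.next, if_true] at h2
    have h3 : ∃ u', Reaches₁ (step (stackRule M))
        (tape (.after (.pop k f q) v) ((S k).map .inr ++ z ++ [.inl k]))
        (tape (.run q (f v (S k).head?)) u') ∧
        u' ~r stackWord ks (Function.update S k (S k).tail) := by
      have h' := h (S k).tail
      cases hS : S k with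
      | nil =>
        rw [hS, List.tail_nil, List.map_nil, List.nil_append] at h'
        have hrot₀ : z ++ [.inl k] ~r stackWord ks (Function.update S k []) := by
          refine List.isRotated_append.trans ?_
          exact h'.symm
        obtain ⟨a, y, hy, hrot⟩ := hcons hrot₀
        refine ⟨_, ?_, hrot⟩
        have h3 := reaches_next (M := M) (.after (.pop k f q) v) a y
        rw [List.map_nil, List.nil_append, hy]
        have e : Ctrl.next M (.after (.pop k f q) v) a = ([a], .run q (f v none)) := by
          cases z with
          | nil => simp at hy; obtain ⟨rfl, -⟩ := hy; rfl
          | cons b z =>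
            simp at hy
            obtain ⟨rfl, -⟩ := hy
            cases b with
            | inl k' => rfl
            | inr x => exact (hz x rfl).elim
        rwa [e] at h3
      | cons x s =>
        rw [hS, List.tail_cons] at h'
        have h3 := reaches_next (M := M) (.after (.pop k f q) v) (.inr x)
          (s.map .inr ++ z ++ [.inl k])
        simp only [Ctrl.next, List.append_nil] at h3
        exact ⟨_, h3, List.isRotated_append.trans h'.symm⟩
    obtain ⟨u', h3, hrot⟩ := h3
    obtain ⟨w, hw, h4⟩ := ih (f v (S k).head?) _ hrot
    exact ⟨w, hw, ((h2.trans_right h1).trans h3).trans h4⟩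
  | load f q ih =>
    obtain ⟨a, u, rfl, hrot⟩ := hcons hu
    obtain ⟨w, hw, h⟩ := ih (f v) S hrot
    exact ⟨w, hw, (reaches_next (M := M) (.run (.load f q) v) a u).trans h⟩
  | branch p q₁ q₂ ih₁ ih₂ =>
    obtain ⟨a, u, rfl, hrot⟩ := hcons hu
    have h := reaches_next (M := M) (.run (.branch p q₁ q₂) v) a u
    simp only [Ctrl.next, TM2.stepAux] at h ⊢
    cases hp : p v <;> rw [hp] at h
    · obtain ⟨w, hw, h'⟩ := ih₂ v S hrot
      exact ⟨w, hw, h.trans h'⟩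
    · obtain ⟨w, hw, h'⟩ := ih₁ v S hrot
      exact ⟨w, hw, h.trans h'⟩
  | goto l =>
    obtain ⟨a, u, rfl, hrot⟩ := hcons hu
    exact ⟨_, ⟨_, rfl, hrot⟩, reaches_next (M := M) (.run (.goto l) v) a u⟩
  | halt =>
    obtain ⟨a, u, rfl, hrot⟩ := hcons hu
    exact ⟨_, rfl, (reaches_next (M := M) (.run .halt v) a u).trans_left (reaches_erase _)⟩

theorem respects_stackRule {ks : List K} (hks : ks.Nodup) (hmem : ∀ k, k ∈ ks) [Nonempty K] :
    Respects (TM2.step M) (step (stackRule M)) (Represents M ks) := by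
  rintro ⟨_ | l, v, S⟩ w h
  · cases h
    rfl
  · obtain ⟨u, rfl, hu⟩ := h
    exact reaches_stepAux hks hmem (M l) v S hu

/-- A stack machine that uses only finitely many labels can be simulated by a queue machine with
the alphabet `Fin N`. -/
theorem exists_fin_of_stackMachine {ks : List K} (hks : ks.Nodup) (hmem : ∀ k, k ∈ ks)
    [Nonempty K] [Finite A] [Finite σ] {L : Finset Λ} (hL : ∀ l ∈ L, TM2.SupportsStmt L (M l))
    {l₀ : Λ} (hl₀ : l₀ ∈ L) (v₀ : σ) :
    ∃ N, 0 < N ∧ ∃ (r : Fin N → List (Fin N) ⊕ (Fin N → List (Fin N))) (enc : K ⊕ A → Fin N)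
      (c : Fin N), Productive r ∧ ∀ S : K → List A,
        (Live r (c :: (stackWord ks S).map enc) ↔ ¬ (eval (TM2.step M) ⟨some l₀, v₀, S⟩).Dom) := by
  have : Finite K := Set.finite_univ_iff.1 ((List.finite_toSet ks).subset fun k _ => hmem k)
  -- Only substatements of the bodies at labels in `L` can be reached, and there are finitely many.
  let Q : Set (TM2.Stmt (fun _ : K => A) Λ σ) := {q | ∃ l ∈ L, q ∈ TM2.stmts₁ (M l)}
  have hQ : Q.Finite := by
    refine (L.finite_toSet.biUnion fun l _ => (TM2.stmts₁ (M l)).finite_toSet).subset ?_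
    rintro q ⟨l, hl, hq⟩
    exact Set.mem_biUnion hl hq
  have hsub : ∀ {q q'}, q ∈ Q → q' ∈ TM2.stmts₁ q → q' ∈ Q := fun ⟨l, hl, hq⟩ hq' =>
    ⟨l, hl, TM2.stmts₁_trans hq hq'⟩
  have hgoto : ∀ {l : σ → Λ} {v}, TM2.Stmt.goto l ∈ Q → M (l v) ∈ Q := fun ⟨l', hl', hq⟩ =>
    ⟨_, TM2.stmts₁_supportsStmt_mono hq (hL l' hl') _, TM2.stmts₁_self⟩
  let C : Set (Ctrl K A Λ σ) :=
    Set.image2 Ctrl.run Q Set.univ ∪ Set.image2 Ctrl.after Q Set.univ ∪ {.erase}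
  have hrun : ∀ {q v}, q ∈ Q → Ctrl.run q v ∈ C := fun hq =>
    .inl (.inl (Set.mem_image2_of_mem hq trivial))
  have hafter : ∀ {q v}, q ∈ Q → Ctrl.after q v ∈ C := fun hq =>
    .inl (.inr (Set.mem_image2_of_mem hq trivial))
  have herase : Ctrl.erase ∈ C := .inr rfl
  have hC : ∀ c ∈ C, ∀ a, (c.next M a).2 ∈ C := by
    rintro c ((⟨q, hq, v, -, rfl⟩ | ⟨q, hq, v, -, rfl⟩) | rfl) a
    · cases q with
      | goto l => exact hrun (hgoto hq)
      | halt => exact herase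
      | load f q => exact hrun (hsub hq (by simp [TM2.stmts₁, TM2.stmts₁_self]))
      | branch p q₁ q₂ =>
        simp only [Ctrl.next]
        cases p v <;> exact hrun (hsub hq (by simp [TM2.stmts₁, TM2.stmts₁_self]))
      | push k f q =>
        simp only [Ctrl.next]
        split
        · exact hrun (hsub hq (by simp [TM2.stmts₁, TM2.stmts₁_self]))
        · exact hrun hq
      | peek k f q => simp only [Ctrl.next]; split; exacts [hafter hq, hrun hq]
      | pop k f q => simp only [Ctrl.next]; split; exacts [hafter hq, hrun hq]
    · cases q with
      | peek k f q =>
        cases a <;> exact hrun (hsub hq (by simp [TM2.stmts₁, TM2.stmts₁_self]))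
      | pop k f q =>
        cases a <;> exact hrun (hsub hq (by simp [TM2.stmts₁, TM2.stmts₁_self]))
      | _ => cases a <;> exact herase
    · exact herase
  have hCfin : C.Finite :=
    ((hQ.image2 _ Set.finite_univ).union (hQ.image2 _ Set.finite_univ)).union
      (Set.finite_singleton _)
  let G : Set ((K ⊕ A) ⊕ Ctrl K A Λ σ) := Set.range .inl ∪ .inr '' C
  have hinl : ∀ a, .inl a ∈ G := fun a => .inl ⟨a, rfl⟩
  have hinr : ∀ {c}, c ∈ C → .inr c ∈ G := fun hc => .inr ⟨_, hc, rfl⟩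
  have hstart : Ctrl.run (M l₀) v₀ ∈ C := hrun ⟨l₀, hl₀, TM2.stmts₁_self⟩
  obtain ⟨N, hN, r, enc, hr, h⟩ := exists_fin (productive_stackRule M) (G := G)
    ((Set.finite_range _).union (hCfin.image _)) ⟨_, hinr hstart⟩ (by
      rintro _ (⟨a, rfl⟩ | ⟨c, hc, rfl⟩)
      · simpa [stackRule] using hinl a
      · rintro (b | b) - x hx
        · rcases List.mem_append.1 hx with hx | hx
          · obtain ⟨a, -, rfl⟩ := List.mem_map.1 hx
            exact hinl a
          · cases List.mem_singleton.1 hx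
            exact hinr (hC c hc b)
        · cases List.mem_singleton.1 hx
          exact hinr herase)
  refine ⟨N, hN, r, fun a => enc (.inl a), enc (.inr (.run (M l₀) v₀)), hr, fun S => ?_⟩
  have h1 := h (tape (.run (M l₀) v₀) (stackWord ks S)) fun x hx => by
    rcases List.mem_cons.1 hx with rfl | hx
    · exact hinr hstart
    · obtain ⟨a, -, rfl⟩ := List.mem_map.1 hx
      exact hinl a
  rw [tape, List.map_cons, List.map_map] at h1
  exact h1.trans (live_iff_of_respects (respects_stackRule hks hmem) ⟨_, rfl, .refl _⟩)

end QueueMachine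

/-! ### Computability of the queue from the input of the machine -/

namespace Turing.PartrecToTM2

theorem trNat_eq_cons {m : ℕ} (hm : m ≠ 0) :
    trNat m = (if m % 2 = 0 then Γ'.bit0 else Γ'.bit1) :: trNat (m / 2) := by
  have key : ∀ p : PosNum, trNat (p : ℕ) = trPosNum p := fun p => by
    rw [trNat, show ((p : ℕ) : Num) = Num.pos p from Num.of_to_nat (Num.pos p)]
    rfl
  obtain ⟨p, rfl⟩ : ∃ p : PosNum, (p : ℕ) = m := by
    cases h : (m : Num) with
    | zero =>
      have := Num.to_of_nat m
      rw [h] at this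
      exact (hm this.symm).elim
    | pos p => exact ⟨p, by rw [← Num.cast_pos, ← h, Num.to_of_nat]⟩
  rw [key]
  cases p with
  | one => simp [trPosNum]
  | bit0 p =>
    rw [PosNum.cast_bit0, show (p : ℕ) + p = 2 * p by ring]
    simp [trPosNum, key]
  | bit1 p =>
    rw [PosNum.cast_bit1, show (p : ℕ) + p + 1 = 2 * p + 1 by ring,
      show (2 * (p : ℕ) + 1) / 2 = p by omega]
    simp [trPosNum, key]

/-- Strong recursion: the binary digits of `m` are its parity bit followed by the digits of `m / 2`,
which are looked up among the earlier values. -/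
theorem primrec_map_trNat (g : Γ' → ℕ) : Primrec fun m => (trNat m).map g := by
  let G : Unit → List (List ℕ) → Option (List ℕ) := fun _ l =>
    if l.length = 0 then some []
    else l[l.length / 2]?.map
      ((if l.length % 2 = 0 then g Γ'.bit0 else g Γ'.bit1) :: ·)
  have hlen : Primrec fun p : Unit × List (List ℕ) => p.2.length :=
    Primrec.list_length.comp Primrec.snd
  have hG : Primrec₂ G := by
    refine Primrec.ite (Primrec.eq.comp hlen (.const 0)) (.const _) ?_
    refine Primrec.option_map
      (Primrec.list_getElem?.comp .snd (Primrec.nat_div.comp hlen (.const 2))) ?_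
    refine Primrec.list_cons.comp (Primrec.ite (Primrec.eq.comp (Primrec.nat_mod.comp
      (hlen.comp .fst) (.const 2)) (.const 0)) (.const _) (.const _)) .snd
  have := Primrec.nat_strong_rec (fun (_ : Unit) m => (trNat m).map g) hG fun _ n => by
    by_cases hn : n = 0
    · subst hn; simp [G]
    · simp only [G, List.length_map, List.length_range, hn, if_false]
      rw [trNat_eq_cons hn, List.getElem?_map, List.getElem?_range (by omega)]
      split <;> simp
  exact this.comp (.const ()) .id

end Turing.PartrecToTM2

namespace AsyncSession

open SType QueueMachine Turing.PartrecToTM2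

theorem encode_cell {N : ℕ} (a : Fin N) (S : SType) :
    (cell a S).encode = 4 :: N :: (List.range N).flatMap fun b =>
      b :: if b = a then S.encode else (wild N).encode := by
  rw [cell, inp, SType.encode, List.flatMap, ← List.map_coe_finRange_eq_range, List.map_map,
    List.ofFn_eq_map]
  congr 4
  funext b
  simp [apply_ite SType.encode, Fin.ext_iff]

theorem encode_queue {N : ℕ} (w : List (Fin N)) :
    (queue w).encode = (w.map Fin.val).foldr (fun a e => 4 :: N :: (List.range N).flatMap fun b =>
      b :: if b = a then e else (wild N).encode) (emptyQueue N).encode := by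
  induction w with
  | nil => rfl
  | cons a w ih => rw [queue, List.foldr_cons, ← queue, encode_cell, ih]; rfl

/-- `N` is fixed, so the code of the queue is a fold over its symbols with constant codes for `wild`
and `emptyQueue`. -/
theorem primrec_encode_queue {N : ℕ} {f : ℕ → List (Fin N)}
    (hf : Primrec fun m => (f m).map Fin.val) : Primrec fun m => (queue (f m)).encode := by
  have hstep : Primrec₂ fun (_ : ℕ) (p : ℕ × List ℕ) => 4 :: N :: (List.range N).flatMap fun b =>
      b :: if b = p.1 then p.2 else (wild N).encode := by
    refine Primrec.list_cons.comp (.const 4) (Primrec.list_cons.comp (.const N) ?_)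
    refine Primrec.list_flatMap (.const _) ?_
    have hp : Primrec fun q : (ℕ × ℕ × List ℕ) × ℕ => q.1.2 := Primrec.snd.comp .fst
    exact Primrec.list_cons.comp .snd
      (Primrec.ite (Primrec.eq.comp .snd (Primrec.fst.comp hp)) (Primrec.snd.comp hp) (.const _))
  exact (Primrec.list_foldr hf (.const _) hstep).of_eq fun m => (encode_queue _).symm

/-! ### Reduction from the halting problem -/

/-- There is a queue machine whose halting problem, for a computable family of queues, is
undecidable. -/
theorem exists_undecidable_queueMachine :
    ∃ (N : ℕ) (r : Fin N → List (Fin N) ⊕ (Fin N → List (Fin N))) (w : ℕ → List (Fin N)),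
      0 < N ∧ Productive r ∧ (Primrec fun m => (w m).map Fin.val) ∧
        ¬ ComputablePred fun m => Live r (w m) := by
  -- The universal function: run the program with number `m` on input 0.
  let U : ℕ →. ℕ := fun m => Nat.Partrec.Code.eval (Denumerable.ofNat Nat.Partrec.Code m) 0
  have hU : Partrec U :=
    Nat.Partrec.Code.eval_part.comp (Computable.ofNat Nat.Partrec.Code) (Computable.const 0)
  obtain ⟨c, hc⟩ := Turing.ToPartrec.Code.exists_code (Nat.Partrec'.part_iff₁.2 hU)
  have hL := tr_supports c .halt
  obtain ⟨N, hN, r, enc, a, hr, h⟩ := exists_fin_of_stackMachine (M := tr)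
    (ks := [.main, .rev, .aux, .stack]) (by decide) (fun k => by cases k <;> simp)
    hL.2 hL.1 none
  let w : ℕ → List (Fin N) := fun m => a :: (stackWord [.main, .rev, .aux, .stack]
    (K'.elim (trList [m]) [] [] [])).map enc
  refine ⟨N, r, w, hN, hr, ?_, fun hdec => ?_⟩
  · have e : ∀ m, (w m).map Fin.val = (a : ℕ) :: (enc (.inl .main) : ℕ) ::
        ((trNat m).map (fun x => (enc (.inr x) : ℕ)) ++
          [(enc (.inr .cons) : ℕ), (enc (.inl .rev) : ℕ), (enc (.inl .aux) : ℕ),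
            (enc (.inl .stack) : ℕ)]) := fun m => by simp [w, stackWord]
    simp only [e]
    exact Primrec.list_cons.comp (.const _) (Primrec.list_cons.comp (.const _)
      (Primrec.list_append.comp (primrec_map_trNat _) (.const _)))
  · have hw : ∀ m, Live r (w m) ↔ ¬ (U m).Dom := fun m => by
      refine (h _).trans (not_congr ?_)
      change (StateTransition.eval (Turing.TM2.step tr) (init c [m])).Dom ↔ _
      rw [tr_eval]
      change (Turing.ToPartrec.Code.eval c [m]).Dom ↔ _
      rw [show c.eval [m] = pure <$> U m from hc ⟨[m], rfl⟩]
      rfl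
    obtain ⟨f, hf, e⟩ := ComputablePred.computable_iff.1 hdec
    -- Liveness is non-termination, so the answer of the decider is negated.
    refine ComputablePred.halting_problem 0 (ComputablePred.computable_iff.2
      ⟨fun c => !f (Encodable.encode c),
        (Primrec.not.to_comp.comp (hf.comp Computable.encode)), funext fun c => ?_⟩)
    have h1 := hw (Encodable.encode c)
    rw [congrFun e (Encodable.encode c)] at h1
    simp only [U, Denumerable.ofNat_encode] at h1
    cases hfc : f (Encodable.encode c) <;> simp [hfc] at h1 ⊢ <;> exact h1

theorem not_isDecidable_asyncSubtype (tin tout : Bool) :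
    ¬ IsDecidable (AsyncSubtype tin tout) := by
  rintro ⟨f, hf, h⟩
  obtain ⟨N, r, w, hN, hr, hw, hu⟩ := exists_undecidable_queueMachine
  refine hu (ComputablePred.computable_iff.2
    ⟨fun m => f (program r).encode (queue (w m)).encode,
      hf.comp (Computable.const _) (primrec_encode_queue hw).to_comp, funext fun m => ?_⟩)
  rw [h _ _ (isSessionType_program hN r) (isSessionType_queue hN _),
    asyncSubtype_program_queue_iff hN hr]

end AsyncSession

theorem mainTheorem4 :
    ¬ AsyncSession.IsDecidable AsyncSession.LETinTout ∧
    ¬ AsyncSession.IsDecidable AsyncSession.LETin ∧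
    ¬ AsyncSession.IsDecidable AsyncSession.LETout ∧
    ¬ AsyncSession.IsDecidable AsyncSession.LEFull :=
  ⟨AsyncSession.not_isDecidable_asyncSubtype true true,
    AsyncSession.not_isDecidable_asyncSubtype true false,
    AsyncSession.not_isDecidable_asyncSubtype false true,
    AsyncSession.not_isDecidable_asyncSubtype false false⟩
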